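/- \textbf{Theorem (a generalization of the discrete analog of Pliss' theorem).} Let $d\ge 0$ be an integer, let $\omega\ge 0$ be real, and let $\mathcal A=\{A_k\}_{k\in\mathbb Z}$ be a sequence of linear isomorphisms $\mathbb R^d\to\mathbb R^d$ such that $\|A_k\|\le M$ and $\|A_k^{-1}\|\le M$ for all $k\in\mathbb Z$ and some $M>0$; here $|\cdot|$ is the Euclidean norm and $\|\cdot\|$ the operator norm. Put $$\Phi_{m,l}=\begin{cases}A_{m-1}\circ\cdots\circ A_l,& m>l,\\ \mathrm{Id},& m=l,\\ A_m^{-1}\circ\cdots\circ A_{l-1}^{-1},& m<l.\end{cases}$$ Let $\mathcal N_\omega(\mathbb Z)$ be the space of sequences $x=(x_k)_{k\in\mathbb Z}$ in $\mathbb R^d$ with $\sup_{k\in\mathbb Z}|x_k|(|k|+1)^\omega<\infty$. The sequence $\mathcal A$ has the \emph{Perron property} $B_\omega(\mathbb Z)$ if for every $f\in\mathcal N_\omega(\mathbb Z)$ there is $x\in\mathcal N_\omega(\mathbb Z)$ with $x_{k+1}=A_kx_k+f_{k+1}$ for all $k\in\mathbb Z$. For $I\subset\mathbb Z$, the sequence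 $\mathcal A$ is \emph{hyperbolic on $I$} if there are $K>0$, $\lambda\in(0,1)$ and complementary projections $P_k,Q_k$ of $\mathbb R^d$ ($k\in I$; $P_k^2=P_k$, $Q_k^2=Q_k$, $P_k+Q_k=\mathrm{Id}$) such that, with $S_k=P_k\mathbb R^d$ and $U_k=Q_k\mathbb R^d$, the following holds whenever all the indices that occur belong to $I$: \begin{itemize} \item $\mathbb R^d=S_k\oplus U_k$, $A_kS_k=S_{k+1}$, $A_kU_k=U_{k+1}$; \item $|\Phi_{k,l}v|\le K\lambda^{k-l}|v|$ for $v\in S_l$, $k\ge l$; \item $|\Phi_{k,l}v|\le K\lambda^{l-k}|v|$ for $v\in U_l$, $k\le l$; \item $\|P_k\|\le K$ and $\|Q_k\|\le K$. \end{itemize} Let $$B^+(\mathcal A)=\{v\in\mathbb R^d: |\Phi_{k,0}v|\to0,\ k\to+\infty\},\qquad B^-(\mathcal A)=\{v\in\mathbb R^d: |\Phi_{k,0}v|\to0,\ k\to-\infty\}.$$ Then $\mathcal A$ has the Perron property $B_\omega(\mathbb Z)$ if and only if $\mathcal A$ is hyperbolic on $\mathbb Z_+=\{k\in\mathbb Z: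 k\ge0\}$, hyperbolic on $\mathbb Z_-=\{k\in\mathbb Z: k\le0\}$, and the spaces $B^+(\mathcal A)$ and $B^-(\mathcal A)$ are transverse, that is, $B^+(\mathcal A)+B^-(\mathcal A)=\mathbb R^d$. -/

import Mathlib

open Filter Topology

/-- Euclidean space `ℝ^d`. -/
abbrev Vec (d : ℕ) : Type := EuclideanSpace ℝ (Fin d)

/-- `forwardProd A l n = A_{l+n-1} ∘ ⋯ ∘ A_l` (the identity for `n = 0`). -/
noncomputable def forwardProd {d : ℕ} (A : ℤ → (Vec d ≃L[ℝ] Vec d)) (l : ℤ) :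
    ℕ → (Vec d ≃L[ℝ] Vec d)
  | 0 => ContinuousLinearEquiv.refl ℝ (Vec d)
  | n + 1 => (forwardProd A l n).trans (A (l + n))

/-- The Cauchy matrix `Φ_{m,l}`: it is `A_{m-1} ∘ ⋯ ∘ A_l` for `m > l`, the identity for `m = l`,
and `A_m⁻¹ ∘ ⋯ ∘ A_{l-1}⁻¹ = (A_{l-1} ∘ ⋯ ∘ A_m)⁻¹` for `m < l`. -/
noncomputable def cauchyMatrix {d : ℕ} (A : ℤ → (Vec d ≃L[ℝ] Vec d)) (m l : ℤ) :
    Vec d ≃L[ℝ] Vec d :=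
  if l ≤ m then forwardProd A l (m - l).toNat else (forwardProd A m (l - m).toNat).symm

/-- Membership in the space `𝒩_ω(ℤ)`: `sup_k |x_k| (|k| + 1)^ω < ∞`. -/
def MemWeighted {d : ℕ} (ω : ℝ) (x : ℤ → Vec d) : Prop :=
  ∃ C : ℝ, ∀ k : ℤ, ‖x k‖ * (|(k : ℝ)| + 1) ^ ω ≤ C

/-- The Perron property `B_ω(ℤ)`. -/
def PerronProperty {d : ℕ} (ω : ℝ) (A : ℤ → (Vec d ≃L[ℝ] Vec d)) : Prop :=
  ∀ f : ℤ → Vec d, MemWeighted ω f →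
    ∃ x : ℤ → Vec d, MemWeighted ω x ∧ ∀ k : ℤ, x (k + 1) = A k (x k) + f (k + 1)

/-- Hyperbolicity of the sequence `A` on a set `I` of integers, with `S_k` the range of `P_k` and
`U_k` the range of `Q_k`. All indices that occur are required to lie in `I`. -/
def HyperbolicOn {d : ℕ} (A : ℤ → (Vec d ≃L[ℝ] Vec d)) (I : Set ℤ) : Prop :=
  ∃ (K : ℝ) (lam : ℝ) (P Q : ℤ → (Vec d →L[ℝ] Vec d)),
    0 < K ∧ 0 < lam ∧ lam < 1 ∧
    (∀ k ∈ I, IsIdempotentElem (P k) ∧ IsIdempotentElem (Q k) ∧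
      P k + Q k = ContinuousLinearMap.id ℝ (Vec d)) ∧
    (∀ k ∈ I, IsCompl (P k).range (Q k).range) ∧
    (∀ k ∈ I, k + 1 ∈ I →
      (P k).range.map ((A k : Vec d →L[ℝ] Vec d) : Vec d →ₗ[ℝ] Vec d) = (P (k + 1)).range ∧
      (Q k).range.map ((A k : Vec d →L[ℝ] Vec d) : Vec d →ₗ[ℝ] Vec d) = (Q (k + 1)).range) ∧
    (∀ k ∈ I, ∀ l ∈ I, l ≤ k → ∀ v ∈ (P l).range,
      ‖cauchyMatrix A k l v‖ ≤ K * lam ^ (k - l) * ‖v‖) ∧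
    (∀ k ∈ I, ∀ l ∈ I, k ≤ l → ∀ v ∈ (Q l).range,
      ‖cauchyMatrix A k l v‖ ≤ K * lam ^ (l - k) * ‖v‖) ∧
    (∀ k ∈ I, ‖P k‖ ≤ K ∧ ‖Q k‖ ≤ K)

/-- The vectors `v` with `Φ_{k,0} v → 0` along the filter `F` on `ℤ`. -/
noncomputable def decaySpace {d : ℕ} (A : ℤ → (Vec d ≃L[ℝ] Vec d)) (F : Filter ℤ) : Submodule ℝ (Vec d) where
  carrier := {v | Tendsto (fun k : ℤ => ‖cauchyMatrix A k 0 v‖) F (𝓝 0)}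
  zero_mem' := by simpa using tendsto_const_nhds
  add_mem' := by
    intro v w hv hw
    simp only [Set.mem_ofPred_eq, ← tendsto_zero_iff_norm_tendsto_zero] at hv hw ⊢
    simpa using hv.add hw
  smul_mem' := by
    intro c v hv
    simp only [Set.mem_ofPred_eq, ← tendsto_zero_iff_norm_tendsto_zero] at hv ⊢
    simpa using hv.const_smul c

/-- `B⁺(A)`: the vectors `v` with `|Φ_{k,0} v| → 0` as `k → +∞`. -/
noncomputable def stableSpace {d : ℕ} (A : ℤ → (Vec d ≃L[ℝ] Vec d)) : Submodule ℝ (Vec d) :=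
  decaySpace A atTop

/-- `B⁻(A)`: the vectors `v` with `|Φ_{k,0} v| → 0` as `k → -∞`. -/
noncomputable def unstableSpace {d : ℕ} (A : ℤ → (Vec d ≃L[ℝ] Vec d)) : Submodule ℝ (Vec d) :=
  decaySpace A atBot

/-- Two subspaces are transverse if together they span the whole space. -/
def Transverse {d : ℕ} (V W : Submodule ℝ (Vec d)) : Prop := V ⊔ W = ⊤

/-! Perron property to hyperbolicity. On a half-line, multiplying the evolution by the weight turns
weighted sequences into bounded ones. Fix a complement `W` of the space of initial vectors with
bounded trajectories. Bounded solutions normalized modulo `W` are unique, and the open mapping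
theorem bounds them by a constant times the forcing (`exists_bound_of_perron`). For a forcing
supported on a finite window of a single trajectory, the solution is explicit
(`isSolution_of_coeff`). Scaling that forcing to unit norm bounds sums of `‖U j v‖⁻¹` by a multiple
of one end term, and such inequalities force exponential rates (`exists_dichotomy`). Removing the
weight costs at most a polynomial factor, absorbed by a larger rate below 1. Transversality comes
from the response to an impulse at time 0.

Converse. On each half-line a Green's function sum solves the equation, since exponential decay
beats the weight (`HyperbolicOn.exists_solution`). Transversality splits the mismatch of the two
solutions at 0 into homogeneous corrections, one decaying forward and one backward. -/

/-! ### The Cauchy matrix as a cocycle -/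

section Cauchy

variable {d : ℕ} (A : ℤ → (Vec d ≃L[ℝ] Vec d))

theorem forwardProd_succ_apply (l : ℤ) (n : ℕ) (v : Vec d) :
    forwardProd A l (n + 1) v = A (l + n) (forwardProd A l n v) := rfl

theorem forwardProd_succ_apply' (l : ℤ) (n : ℕ) (v : Vec d) :
    forwardProd A l (n + 1) v = forwardProd A (l + 1) n (A l v) := by
  induction n with
  | zero => simp [forwardProd]
  | succ n ih =>
    rw [forwardProd_succ_apply, ih, forwardProd_succ_apply]
    congr 2
    push_cast
    ring

@[simp]
theorem cauchyMatrix_self (k : ℤ) (v : Vec d) : cauchyMatrix A k k v = v := by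
  simp [cauchyMatrix, forwardProd]

/-- A single recurrence on both sides of `l`, from which the cocycle law follows by two-sided
induction. For `k < l` the factor of the product nearest `k` is peeled off. -/
theorem cauchyMatrix_succ (k l : ℤ) (v : Vec d) :
    cauchyMatrix A (k + 1) l v = A k (cauchyMatrix A k l v) := by
  rcases le_or_gt l k with h | h
  · obtain ⟨n, rfl⟩ := Int.le.dest h
    have h1 : (l + (n : ℤ) + 1 - l).toNat = n + 1 := by omega
    have h2 : (l + (n : ℤ) - l).toNat = n := by omega
    rw [cauchyMatrix, cauchyMatrix, if_pos (by omega), if_pos h, h1, h2]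
    rfl
  · obtain ⟨n, rfl⟩ := Int.le.dest (Int.add_one_le_iff.2 h)
    have h2 : (k + 1 + (n : ℤ) - k).toNat = n + 1 := by omega
    rw [cauchyMatrix, cauchyMatrix, if_neg (not_le.2 h), h2]
    obtain ⟨u, rfl⟩ := (forwardProd A k (n + 1)).surjective v
    rw [ContinuousLinearEquiv.symm_apply_apply, forwardProd_succ_apply']
    split_ifs with h3
    · obtain rfl : n = 0 := by omega
      simp [forwardProd]
    · have h1 : (k + 1 + (n : ℤ) - (k + 1)).toNat = n := by omega
      rw [h1, ContinuousLinearEquiv.symm_apply_apply]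

theorem cauchyMatrix_comp (k l m : ℤ) (v : Vec d) :
    cauchyMatrix A k l (cauchyMatrix A l m v) = cauchyMatrix A k m v := by
  induction k using Int.inductionOn' (b := l) with
  | zero => simp
  | succ k _ ih => rw [cauchyMatrix_succ, cauchyMatrix_succ, ih]
  | pred k _ ih =>
    apply (A (k - 1)).injective
    rw [← cauchyMatrix_succ, ← cauchyMatrix_succ, sub_add_cancel, ih]

theorem cauchyMatrix_symm (k l : ℤ) : (cauchyMatrix A k l).symm = cauchyMatrix A l k := by
  refine ContinuousLinearEquiv.ext (funext fun v => ?_)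
  rw [ContinuousLinearEquiv.symm_apply_eq, cauchyMatrix_comp, cauchyMatrix_self]

end Cauchy

/-! ### Polynomial weights against exponential rates -/

section Weight

/-- The weight `(|k| + 1) ^ ω`. -/
noncomputable def polyWeight (ω : ℝ) (k : ℤ) : ℝ := (|(k : ℝ)| + 1) ^ ω

theorem polyWeight_pos (ω : ℝ) (k : ℤ) : 0 < polyWeight ω k :=
  Real.rpow_pos_of_pos (by positivity) ω

theorem polyWeight_neg (ω : ℝ) (k : ℤ) : polyWeight ω (-k) = polyWeight ω k := by
  simp [polyWeight]

theorem polyWeight_mono {ω : ℝ} (hω : 0 ≤ ω) {m n : ℕ} (h : m ≤ n) :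
    polyWeight ω m ≤ polyWeight ω n := by
  refine Real.rpow_le_rpow (by positivity) ?_ hω
  simpa using h

/-- Submultiplicativity: `|k| + 1 ≤ (|l| + 1) (|k - l| + 1)`. -/
theorem polyWeight_le_mul {ω : ℝ} (hω : 0 ≤ ω) (k l : ℤ) :
    polyWeight ω k ≤ polyWeight ω l * (((k - l).natAbs : ℝ) + 1) ^ ω := by
  have h : (((k - l).natAbs : ℕ) : ℝ) = |(k : ℝ) - l| := by
    rw [Nat.cast_natAbs]; push_cast; rfl
  rw [polyWeight, polyWeight, h, ← Real.mul_rpow (by positivity) (by positivity)]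
  refine Real.rpow_le_rpow (by positivity) ?_ hω
  have h1 : |(k : ℝ)| ≤ |(l : ℝ)| + |(k : ℝ) - l| := by
    simpa using abs_add_le (l : ℝ) (k - l)
  nlinarith [abs_nonneg (l : ℝ), abs_nonneg ((k : ℝ) - l)]

/-- Write `lam = √lam * √lam`: one factor absorbs the polynomial, the other remains as the rate. -/
theorem exists_rpow_mul_pow_le {lam : ℝ} (h0 : 0 < lam) (h1 : lam < 1) (ω : ℝ) :
    ∃ C μ : ℝ, 0 < C ∧ 0 < μ ∧ μ < 1 ∧ ∀ n : ℕ, ((n : ℝ) + 1) ^ ω * lam ^ n ≤ C * μ ^ n := by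
  have hμ0 : 0 < √lam := Real.sqrt_pos.2 h0
  have hμ1 : √lam < 1 := by rw [Real.sqrt_lt' one_pos]; simpa using h1
  have hsq : √lam * √lam = lam := Real.mul_self_sqrt h0.le
  obtain ⟨C, hC⟩ := (tendsto_pow_const_mul_const_pow_of_abs_lt_one ⌈ω⌉₊
    (by rwa [abs_of_pos hμ0] : |√lam| < 1)).bddAbove_range
  have hC' : ∀ n : ℕ, (n : ℝ) ^ ⌈ω⌉₊ * √lam ^ n ≤ C := fun n => hC ⟨n, rfl⟩
  have hCpos : 0 < C := lt_of_lt_of_le (by positivity) (hC' 1)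
  refine ⟨C / √lam, √lam, by positivity, hμ0, hμ1, fun n => ?_⟩
  have h2 : ((n : ℝ) + 1) ^ ω ≤ ((n : ℝ) + 1) ^ ⌈ω⌉₊ := by
    rw [← Real.rpow_natCast]
    exact Real.rpow_le_rpow_of_exponent_le (by linarith [n.cast_nonneg (α := ℝ)]) (Nat.le_ceil ω)
  have h3 := hC' (n + 1)
  push_cast at h3
  have h4 : ((n : ℝ) + 1) ^ ω * √lam ^ n ≤ C / √lam := by
    rw [le_div_iff₀ hμ0]
    calc ((n : ℝ) + 1) ^ ω * √lam ^ n * √lam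
        ≤ ((n : ℝ) + 1) ^ ⌈ω⌉₊ * √lam ^ n * √lam := by gcongr
      _ ≤ C := by rw [mul_assoc, ← pow_succ]; exact h3
  calc ((n : ℝ) + 1) ^ ω * lam ^ n = ((n : ℝ) + 1) ^ ω * √lam ^ n * √lam ^ n := by
        rw [mul_assoc, ← mul_pow, hsq]
    _ ≤ C / √lam * √lam ^ n := by gcongr

theorem summable_pow_natAbs {μ : ℝ} (h0 : 0 < μ) (h1 : μ < 1) :
    Summable fun n : ℤ => μ ^ n.natAbs :=
  Summable.of_nat_of_neg (by simpa using summable_geometric_of_lt_one h0.le h1)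
    (by simpa using summable_geometric_of_lt_one h0.le h1)

end Weight

/-! ### Exponential dichotomy from solvability in bounded sequences -/

section HalfLine

/-- With `S m` the sum up to `m`, the hypothesis reads `S m ≤ R (S m - S (m - 1))` for `m > l`.
Hence `S (m - 1) ≤ (1 - R⁻¹) S m`, which is iterated from `S l = a l`. -/
theorem le_pow_mul_of_sum_le_right {a : ℕ → ℝ} {R : ℝ} (hR : 1 < R) {l : ℕ}
    (h : ∀ m, l ≤ m → ∑ j ∈ Finset.Icc l m, a j ≤ R * a m) (n : ℕ) :
    a l ≤ R * (1 - R⁻¹) ^ n * a (l + n) := by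
  have hR0 : 0 < R := by linarith
  have hθ : 0 ≤ 1 - R⁻¹ := by have := inv_lt_one_of_one_lt₀ hR; linarith
  have key : ∀ n, a l ≤ (1 - R⁻¹) ^ n * ∑ j ∈ Finset.Icc l (l + n), a j := by
    intro n
    induction n with
    | zero => simp
    | succ n ih =>
      refine ih.trans ?_
      rw [pow_succ, mul_assoc]
      gcongr
      have h1 := h (l + (n + 1)) (by omega)
      rw [← add_assoc] at h1 ⊢
      rw [Finset.sum_Icc_succ_top (by omega)] at h1 ⊢
      have h2 := mul_le_mul_of_nonneg_left h1 (inv_nonneg.2 hR0.le)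
      rw [inv_mul_cancel_left₀ hR0.ne'] at h2
      linarith
  calc a l ≤ (1 - R⁻¹) ^ n * ∑ j ∈ Finset.Icc l (l + n), a j := key n
    _ ≤ (1 - R⁻¹) ^ n * (R * a (l + n)) := by gcongr; exact h _ (by omega)
    _ = _ := by ring

theorem le_pow_mul_of_sum_le_left {a : ℕ → ℝ} {R : ℝ} (hR : 1 < R) {m : ℕ}
    (h : ∀ l, l ≤ m → ∑ j ∈ Finset.Icc l m, a j ≤ R * a l) (n : ℕ) (hn : n ≤ m) :
    a m ≤ R * (1 - R⁻¹) ^ n * a (m - n) := by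
  have hR0 : 0 < R := by linarith
  have hθ : 0 ≤ 1 - R⁻¹ := by have := inv_lt_one_of_one_lt₀ hR; linarith
  have key : ∀ n ≤ m, a m ≤ (1 - R⁻¹) ^ n * ∑ j ∈ Finset.Icc (m - n) m, a j := by
    intro n hn
    induction n with
    | zero => simp
    | succ n ih =>
      refine (ih (by omega)).trans ?_
      rw [pow_succ, mul_assoc]
      gcongr
      have h1 := h (m - (n + 1)) (by omega)
      have h3 : Finset.Icc (m - (n + 1)) m = insert (m - (n + 1)) (Finset.Icc (m - n) m) := by
        ext j; simp only [Finset.mem_Icc, Finset.mem_insert]; omega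
      rw [h3, Finset.sum_insert (by simp; omega)] at h1 ⊢
      have h2 := mul_le_mul_of_nonneg_left h1 (inv_nonneg.2 hR0.le)
      rw [inv_mul_cancel_left₀ hR0.ne'] at h2
      linarith
  calc a m ≤ (1 - R⁻¹) ^ n * ∑ j ∈ Finset.Icc (m - n) m, a j := key n hn
    _ ≤ (1 - R⁻¹) ^ n * (R * a (m - n)) := by gcongr; exact h _ (by omega)
    _ = _ := by ring

variable {E : Type*} [NormedAddCommGroup E] [NormedSpace ℝ E]

/-- The vectors whose trajectory under the operators `U n` is bounded. -/
def boundedSpace (U : ℕ → (E ≃L[ℝ] E)) : Submodule ℝ E where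
  carrier := {v | ∃ C, ∀ n, ‖U n v‖ ≤ C}
  zero_mem' := ⟨0, by simp⟩
  add_mem' := by
    rintro v w ⟨C, hC⟩ ⟨D, hD⟩
    exact ⟨C + D, fun n => by rw [map_add]; exact norm_add_le_of_le (hC n) (hD n)⟩
  smul_mem' := by
    rintro c v ⟨C, hC⟩
    exact ⟨‖c‖ * C, fun n => by rw [map_smul, norm_smul]; gcongr; exact hC n⟩

/-- `y` solves the inhomogeneous equation with right-hand side `f` for the evolution `U`, with
initial condition modulo `W`. -/
def IsSolution (U : ℕ → (E ≃L[ℝ] E)) (W : Submodule ℝ E) (f y : ℕ → E) : Prop :=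
  (U 0).symm (y 0 - f 0) ∈ W ∧ ∀ n, y (n + 1) = U (n + 1) ((U n).symm (y n)) + f (n + 1)

/-- The difference of two solutions is a homogeneous trajectory `U n v`; boundedness and the
normalization put `v` in two disjoint subspaces. -/
theorem IsSolution.unique {U : ℕ → (E ≃L[ℝ] E)} {W : Submodule ℝ E}
    (hW : Disjoint (boundedSpace U) W) {f y z : ℕ → E} (hy : IsSolution U W f y)
    (hz : IsSolution U W f z) {C D : ℝ} (hC : ∀ n, ‖y n‖ ≤ C) (hD : ∀ n, ‖z n‖ ≤ D) : y = z := by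
  set v := (U 0).symm (y 0 - z 0) with hv
  have h1 : ∀ n, y n - z n = U n v := by
    intro n
    induction n with
    | zero => simp [hv]
    | succ n ih =>
      rw [hy.2, hz.2, add_sub_add_right_eq_sub, ← map_sub, ← map_sub, ih,
        ContinuousLinearEquiv.symm_apply_apply]
  have h2 : v ∈ boundedSpace U := ⟨C + D, fun n => by
    rw [← h1]; exact norm_sub_le_of_le (hC n) (hD n)⟩
  have h3 : v ∈ W := by
    have := W.sub_mem hy.1 hz.1
    rwa [← map_sub, sub_sub_sub_cancel_right] at this
  have h4 : v = 0 := Submodule.disjoint_def.1 hW v h2 h3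
  ext1 n
  rw [← sub_eq_zero, h1, h4, map_zero]

-- The pairs (solution, forcing) form a closed subspace of a Banach space, and the projection to the
-- forcing is onto. The open mapping theorem gives a preimage of controlled norm, which uniqueness
-- identifies with `y`.
open BoundedContinuousFunction in
theorem exists_bound_of_perron [FiniteDimensional ℝ E] {U : ℕ → (E ≃L[ℝ] E)} {W : Submodule ℝ E}
    (hW : IsCompl (boundedSpace U) W)
    (hU : ∀ f : ℕ → E, (∃ C, ∀ n, ‖f n‖ ≤ C) → ∃ y : ℕ → E, (∃ C, ∀ n, ‖y n‖ ≤ C) ∧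
      ∀ n, y (n + 1) = U (n + 1) ((U n).symm (y n)) + f (n + 1)) :
    ∃ r : ℝ, 0 < r ∧ ∀ (f y : ℕ → E) (c : ℝ), 0 ≤ c → (∀ n, ‖f n‖ ≤ c) → (∃ C, ∀ n, ‖y n‖ ≤ C) →
      IsSolution U W f y → ∀ n, ‖y n‖ ≤ r * c := by
  have : CompleteSpace E := FiniteDimensional.complete ℝ E
  let D : Submodule ℝ ((ℕ →ᵇ E) × (ℕ →ᵇ E)) :=
    { carrier := {p | IsSolution U W p.2 p.1}
      zero_mem' := by simp [IsSolution]
      add_mem' := by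
        rintro p q ⟨hp, hp'⟩ ⟨hq, hq'⟩
        refine ⟨?_, fun n => ?_⟩
        · convert W.add_mem hp hq using 1
          rw [← map_add]; congr 1; simp; abel
        · simp only [Prod.fst_add, Prod.snd_add, coe_add, Pi.add_apply, hp', hq', map_add]
          abel
      smul_mem' := by
        rintro c p ⟨hp, hp'⟩
        refine ⟨?_, fun n => ?_⟩
        · convert W.smul_mem c hp using 1
          rw [← map_smul]; congr 1; simp [smul_sub]
        · simp only [Prod.smul_fst, Prod.smul_snd, coe_smul, hp', map_smul, smul_add] }
  have hD : IsClosed (D : Set ((ℕ →ᵇ E) × (ℕ →ᵇ E))) := by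
    have h1 : ∀ n, Continuous fun p : (ℕ →ᵇ E) × (ℕ →ᵇ E) => p.1 n := fun n =>
      (continuous_eval_const n).comp continuous_fst
    have h2 : ∀ n, Continuous fun p : (ℕ →ᵇ E) × (ℕ →ᵇ E) => p.2 n := fun n =>
      (continuous_eval_const n).comp continuous_snd
    have h3 : IsClosed {p : (ℕ →ᵇ E) × (ℕ →ᵇ E) | (U 0).symm (p.1 0 - p.2 0) ∈ W} :=
      W.closed_of_finiteDimensional.preimage
        ((U 0).symm.continuous.comp ((h1 0).sub (h2 0)))
    have h4 : IsClosed {p : (ℕ →ᵇ E) × (ℕ →ᵇ E) |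
        ∀ n, p.1 (n + 1) = U (n + 1) ((U n).symm (p.1 n)) + p.2 (n + 1)} := by
      rw [Set.ofPred_forall]
      exact isClosed_iInter fun n => isClosed_eq (h1 _)
        (((U (n + 1)).continuous.comp ((U n).symm.continuous.comp (h1 n))).add (h2 _))
    exact h3.inter h4
  have : CompleteSpace D := hD.completeSpace_coe
  let π : D →L[ℝ] (ℕ →ᵇ E) := (ContinuousLinearMap.snd ℝ _ _).comp D.subtypeL
  have hπ : Function.Surjective π := by
    intro f
    obtain ⟨y, ⟨C, hC⟩, hy⟩ := hU f ⟨‖f‖, f.norm_coe_le_norm⟩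
    -- Subtracting the bounded trajectory of `v` leaves `w ∈ W` as initial condition.
    obtain ⟨v, ⟨C', hC'⟩, w, hw, hvw⟩ := Submodule.mem_sup.1
      (hW.sup_eq_top ▸ Submodule.mem_top : (U 0).symm (y 0 - f 0) ∈ boundedSpace U ⊔ W)
    refine ⟨⟨(ofNormedAddCommGroupDiscrete (fun n => y n - U n v) (C + C')
      fun n => norm_sub_le_of_le (hC n) (hC' n), f), ?_, fun n => ?_⟩, rfl⟩
    · simp only [coe_ofNormedAddCommGroupDiscrete]
      rw [sub_right_comm, map_sub, ← hvw]
      simpa using hw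
    · simp [hy, sub_add_eq_add_sub]
  obtain ⟨r, hr, h⟩ := π.exists_preimage_norm_le hπ
  refine ⟨r, hr, fun f y c hc hf ⟨C, hC⟩ hy n => ?_⟩
  set F : ℕ →ᵇ E := ofNormedAddCommGroupDiscrete f c hf with hF
  obtain ⟨⟨⟨z, g⟩, hz⟩, hzg, hzn⟩ := h F
  obtain rfl : g = F := hzg
  have hFf : (F : ℕ → E) = f := rfl
  have hyz : y = z := by
    refine IsSolution.unique hW.disjoint hy ?_ hC z.norm_coe_le_norm
    simpa [D, hFf] using hz
  calc ‖y n‖ = ‖z n‖ := by rw [hyz]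
    _ ≤ ‖z‖ := z.norm_coe_le_norm n
    _ ≤ ‖(z, F)‖ := norm_fst_le (z, F)
    _ ≤ r * ‖F‖ := hzn
    _ ≤ r * c := by gcongr; exact (norm_le hc).2 hf

/-- Green's formula: the `P` part accumulates the past, the complementary part minus the future, a
finite sum because `c` vanishes beyond `m`. -/
theorem isSolution_of_coeff {U : ℕ → (E ≃L[ℝ] E)} {W : Submodule ℝ E} (P : E →L[ℝ] E)
    (hPW : ∀ v, v - P v ∈ W) (v : E) (c : ℕ → ℝ) {m : ℕ} (hc : ∀ n, m < n → c n = 0) :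
    IsSolution U W (fun n => c n • U n v) (fun n => (∑ j ∈ Finset.range (n + 1), c j) • U n (P v) -
      (∑ j ∈ Finset.Ioc n m, c j) • U n (v - P v)) := by
  refine ⟨?_, fun n => ?_⟩
  · have h : (U 0).symm ((∑ j ∈ Finset.range (0 + 1), c j) • U 0 (P v) -
        (∑ j ∈ Finset.Ioc 0 m, c j) • U 0 (v - P v) - c 0 • U 0 v) =
        -(∑ j ∈ Finset.Ioc 0 m, c j + c 0) • (v - P v) := by
      simp only [map_sub, map_smul, ContinuousLinearEquiv.symm_apply_apply, zero_add,
        Finset.sum_range_one]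
      module
    rw [h]
    exact W.smul_mem _ (hPW v)
  · have h : ∑ j ∈ Finset.Ioc n m, c j = c (n + 1) + ∑ j ∈ Finset.Ioc (n + 1) m, c j := by
      rcases le_or_gt m n with h | h
      · rw [Finset.Ioc_eq_empty (by omega), Finset.Ioc_eq_empty (by omega), hc _ (by omega)]
        simp
      · rw [← Finset.sum_insert (by simp)]
        congr 1
        ext j; simp only [Finset.mem_Ioc, Finset.mem_insert]; omega
    beta_reduce
    rw [Finset.sum_range_succ _ (n + 1), h]
    simp only [map_sub, map_smul, ContinuousLinearEquiv.symm_apply_apply]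
    module

/-- An exponential dichotomy for the evolution `U` from solvability in bounded sequences. -/
theorem exists_dichotomy [FiniteDimensional ℝ E] {U : ℕ → (E ≃L[ℝ] E)}
    (hU : ∀ f : ℕ → E, (∃ C, ∀ n, ‖f n‖ ≤ C) → ∃ y : ℕ → E, (∃ C, ∀ n, ‖y n‖ ≤ C) ∧
      ∀ n, y (n + 1) = U (n + 1) ((U n).symm (y n)) + f (n + 1)) :
    ∃ (K lam : ℝ) (P : E →L[ℝ] E), 0 < K ∧ 0 < lam ∧ lam < 1 ∧ IsIdempotentElem P ∧
      (∀ v, (∃ C, ∀ n, ‖U n v‖ ≤ C) → P v = v) ∧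
      (∀ l n v, ‖U (l + n) (P v)‖ ≤ K * lam ^ n * ‖U l (P v)‖) ∧
      (∀ l n v, ‖U l (v - P v)‖ ≤ K * lam ^ n * ‖U (l + n) (v - P v)‖) ∧
      (∀ n v, ‖U n (P v)‖ ≤ K * ‖U n v‖) := by
  obtain ⟨W, hW⟩ := (boundedSpace U).exists_isCompl
  obtain ⟨r, hr, hbound⟩ := exists_bound_of_perron hW hU
  let P : E →L[ℝ] E := LinearMap.toContinuousLinearMap ((boundedSpace U).projection W hW)
  have hPmem : ∀ v, P v ∈ boundedSpace U := fun v => Submodule.projection_apply_mem hW v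
  have hPV : ∀ v ∈ boundedSpace U, P v = v := fun v hv =>
    Submodule.projection_apply_left hW ⟨v, hv⟩
  have hPW : ∀ v, v - P v ∈ W := by
    intro v
    have : P (v - P v) = 0 := by rw [map_sub, hPV _ (hPmem v), sub_self]
    exact (Submodule.projection_apply_eq_zero_iff hW).1 this
  have hPP : ∀ v, P (P v) = P v := fun v => hPV _ (hPmem v)
  -- The a priori bound for Green's formula. That solution is bounded: `P v` has a bounded
  -- trajectory and the second sum is empty past `m`.
  have main : ∀ (v : E) (c : ℕ → ℝ) (m : ℕ), (∀ n, m < n → c n = 0) → ∀ B : ℝ, 0 ≤ B →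
      (∀ n, |c n| * ‖U n v‖ ≤ B) → ∀ n, ‖(∑ j ∈ Finset.range (n + 1), c j) • U n (P v) -
      (∑ j ∈ Finset.Ioc n m, c j) • U n (v - P v)‖ ≤ r * B := by
    intro v c m hc B hB hcB
    refine hbound _ _ B hB (fun n => by rw [norm_smul]; exact hcB n) ?_
      (isSolution_of_coeff P hPW v c hc)
    obtain ⟨C, hC⟩ := hPmem v
    have hsum : ∀ s : Finset ℕ, |∑ j ∈ s, c j| ≤ ∑ j ∈ Finset.range (m + 1), |c j| := by
      intro s
      refine (Finset.abs_sum_le_sum_abs _ _).trans ?_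
      rw [← Finset.sum_filter_add_sum_filter_not s (· ≤ m),
        Finset.sum_eq_zero (s := s.filter (¬ · ≤ m))
          (fun j hj => by rw [hc j (by simpa using (Finset.mem_filter.1 hj).2), abs_zero]), add_zero]
      refine Finset.sum_le_sum_of_subset_of_nonneg (fun j hj => ?_) fun _ _ _ => abs_nonneg _
      have := (Finset.mem_filter.1 hj).2
      simp; omega
    set S := ∑ j ∈ Finset.range (m + 1), |c j| with hS
    have hS0 : 0 ≤ S := Finset.sum_nonneg fun _ _ => abs_nonneg _
    set D := ∑ n ∈ Finset.range (m + 1), ‖U n (v - P v)‖ with hD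
    have hD0 : 0 ≤ D := Finset.sum_nonneg fun _ _ => norm_nonneg _
    refine ⟨S * C + S * D, fun n => norm_sub_le_of_le ?_ ?_⟩
    · rw [norm_smul]
      exact mul_le_mul (hsum _) (hC n) (norm_nonneg _) hS0
    · rcases le_or_gt n m with h | h
      · rw [norm_smul]
        refine mul_le_mul (hsum _) ?_ (norm_nonneg _) hS0
        exact Finset.single_le_sum (f := fun n => ‖U n (v - P v)‖) (fun _ _ => norm_nonneg _)
          (by rw [Finset.mem_range]; omega)
      · rw [Finset.Ioc_eq_empty (by omega)]
        simpa using mul_nonneg hS0 hD0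
  -- The extra 1 makes `1 - R⁻¹` positive, and pays for the term `j = k` missing from the sum over
  -- the strict future of `k`.
  set R := r + 1 with hR
  have hR1 : 1 < R := by linarith
  have hRinv : R⁻¹ < 1 := inv_lt_one_of_one_lt₀ hR1
  have hRinv0 : 0 < R⁻¹ := by positivity
  have coeff : ∀ (v : E) (l m : ℕ), v ≠ 0 → ∀ n,
      |(if n ∈ Finset.Icc l m then ‖U n v‖⁻¹ else 0)| * ‖U n v‖ ≤ 1 := by
    intro v l m hv n
    have : ‖U n v‖ ≠ 0 := by simpa using hv
    split_ifs
    · rw [abs_of_nonneg (by positivity), inv_mul_cancel₀ this]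
    · simp
  refine ⟨R, 1 - R⁻¹, P, by positivity, by linarith, by linarith, ?_, fun v hv => hPV v hv,
    ?_, ?_, ?_⟩
  · ext1 v
    exact hPP v
  · intro l n v
    rcases eq_or_ne (P v) 0 with hv | hv
    · simp [hv]
    have hpos : ∀ n, 0 < ‖U n (P v)‖ := fun n => by simpa using hv
    have h := le_pow_mul_of_sum_le_right (a := fun j => ‖U j (P v)‖⁻¹) hR1 (l := l) ?_ n
    · have h1 := hpos l
      have h2 := hpos (l + n)
      rw [inv_le_iff_one_le_mul₀ h1, mul_assoc, mul_comm (_⁻¹), ← mul_assoc, ← div_eq_mul_inv,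
        one_le_div h2] at h
      exact h
    · intro m hm
      -- Forcing of unit norm on the window; at time `m` the solution is the whole sum times `U m (P
      -- v)`.
      have h := main (P v) (fun n => if n ∈ Finset.Icc l m then ‖U n (P v)‖⁻¹ else 0) m
        (fun n hn => if_neg (by rw [Finset.mem_Icc]; omega))
        1 zero_le_one (coeff (P v) l m hv) m
      simp only [hPP, sub_self, map_zero, smul_zero, sub_zero, mul_one] at h
      rw [norm_smul, ← Finset.sum_filter, Finset.filter_mem_eq_inter,
        Finset.inter_eq_right.2 (by intro j; simp only [Finset.mem_Icc, Finset.mem_range]; omega),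
        Real.norm_of_nonneg (Finset.sum_nonneg fun _ _ => by positivity)] at h
      rw [← div_eq_mul_inv, le_div_iff₀ (hpos m)]
      linarith
  · intro l n v
    rcases eq_or_ne (v - P v) 0 with hv | hv
    · simp [hv]
    have hPz : P (v - P v) = 0 := by rw [map_sub, hPP, sub_self]
    generalize v - P v = w at hv hPz ⊢
    have hpos : ∀ n, 0 < ‖U n w‖ := fun n => by simpa using hv
    suffices hsum : ∀ k ≤ l + n, ∑ j ∈ Finset.Icc k (l + n), ‖U j w‖⁻¹ ≤ R * ‖U k w‖⁻¹ by
      have h := le_pow_mul_of_sum_le_left hR1 hsum n (Nat.le_add_left n l)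
      have h1 := hpos l
      have h2 := hpos (l + n)
      rw [Nat.add_sub_cancel, inv_le_iff_one_le_mul₀ h2, mul_assoc, mul_comm (_⁻¹), ← mul_assoc,
        ← div_eq_mul_inv, one_le_div h1] at h
      exact h
    intro k hk
    have h := main w (fun j => if j ∈ Finset.Icc (k + 1) (l + n) then ‖U j w‖⁻¹ else 0) (l + n)
      (fun j hj => if_neg (by rw [Finset.mem_Icc]; omega))
      1 zero_le_one (coeff w (k + 1) (l + n) hv) k
    simp only [hPz, sub_zero, map_zero, smul_zero, zero_sub, mul_one, norm_neg] at h
    rw [norm_smul, ← Finset.sum_filter, Finset.filter_mem_eq_inter,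
      Finset.inter_eq_right.2 (by intro j; simp only [Finset.mem_Icc, Finset.mem_Ioc]; omega),
      Real.norm_of_nonneg (Finset.sum_nonneg fun _ _ => by positivity)] at h
    have h3 : Finset.Icc k (l + n) = insert k (Finset.Icc (k + 1) (l + n)) := by
      ext j; simp only [Finset.mem_Icc, Finset.mem_insert]; omega
    rw [h3, Finset.sum_insert (by simp), ← div_eq_mul_inv, le_div_iff₀ (hpos k), add_mul,
      inv_mul_cancel₀ (hpos k).ne']
    linarith
  · intro n v
    -- For an impulse at time `n`, the solution at `n` is `U n (P v)`.
    have h := main v (fun j => if j = n then 1 else 0) n (fun j hj => if_neg (by omega)) ‖U n v‖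
      (norm_nonneg _) (fun j => by split_ifs with hj <;> simp [hj]) n
    simp only [Finset.sum_ite_eq', Finset.mem_range, lt_add_iff_pos_right, Nat.lt_one_iff,
      pos_of_gt, if_true, one_smul, Finset.Ioc_self, Finset.notMem_empty, if_false,
      zero_smul, sub_zero] at h
    refine h.trans ?_
    gcongr
    linarith

end HalfLine

/-! ### From the Perron property to hyperbolicity and transversality -/

section Forward

variable {d : ℕ} {A : ℤ → (Vec d ≃L[ℝ] Vec d)}

/-- Conjugating one idempotent at time 0 by the Cauchy matrix makes the family invariant
automatically. The constant grows to `K + 1` to bound `1 - Pk k`. -/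
theorem hyperbolicOn_of_idempotent {I : Set ℤ} {K lam : ℝ} {P : Vec d →L[ℝ] Vec d} (hK : 0 < K)
    (h0 : 0 < lam) (h1 : lam < 1) (hP : IsIdempotentElem P)
    (hS : ∀ k ∈ I, ∀ l ∈ I, l ≤ k → ∀ v,
      ‖cauchyMatrix A k 0 (P v)‖ ≤ K * lam ^ (k - l) * ‖cauchyMatrix A l 0 (P v)‖)
    (hU : ∀ k ∈ I, ∀ l ∈ I, k ≤ l → ∀ v,
      ‖cauchyMatrix A k 0 (v - P v)‖ ≤ K * lam ^ (l - k) * ‖cauchyMatrix A l 0 (v - P v)‖)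
    (hbd : ∀ k ∈ I, ∀ v, ‖cauchyMatrix A k 0 (P v)‖ ≤ K * ‖cauchyMatrix A k 0 v‖) :
    HyperbolicOn A I := by
  let Pk : ℤ → (Vec d →L[ℝ] Vec d) := fun k =>
    (cauchyMatrix A k 0 : Vec d →L[ℝ] Vec d) ∘L P ∘L (cauchyMatrix A 0 k : Vec d →L[ℝ] Vec d)
  have hPk : ∀ k v, Pk k v = cauchyMatrix A k 0 (P (cauchyMatrix A 0 k v)) := fun _ _ => rfl
  have hPP : ∀ v, P (P v) = P v := fun v => DFunLike.congr_fun hP v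
  have hid : ∀ k, IsIdempotentElem (Pk k) := fun k => by
    refine ContinuousLinearMap.ext fun v => ?_
    simp only [mul_apply_eq_comp, hPk, cauchyMatrix_comp, cauchyMatrix_self, hPP]
  have hQk : ∀ k v, (1 - Pk k) v =
      cauchyMatrix A k 0 (cauchyMatrix A 0 k v - P (cauchyMatrix A 0 k v)) := fun k v => by
    rw [map_sub, cauchyMatrix_comp, cauchyMatrix_self]; rfl
  have hPA : ∀ k v, Pk (k + 1) (A k v) = A k (Pk k v) := fun k v => by
    have h : cauchyMatrix A 0 (k + 1) (A k v) = cauchyMatrix A 0 k v := by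
      have := cauchyMatrix_comp A 0 (k + 1) k v
      rwa [cauchyMatrix_succ, cauchyMatrix_self] at this
    rw [hPk, hPk, h, cauchyMatrix_succ]
  have hmap : ∀ (k : ℤ) (T T' : Vec d →L[ℝ] Vec d), (∀ v, T' (A k v) = A k (T v)) →
      T.range.map ((A k : Vec d →L[ℝ] Vec d) : Vec d →ₗ[ℝ] Vec d) = T'.range := by
    intro k T T' h
    ext u
    constructor
    · rintro ⟨_, ⟨v, rfl⟩, rfl⟩
      exact ⟨A k v, h v⟩
    · rintro ⟨v, rfl⟩
      obtain ⟨v, rfl⟩ := (A k).surjective v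
      exact ⟨T v, ⟨v, rfl⟩, (h v).symm⟩
  refine ⟨K + 1, lam, Pk, fun k => 1 - Pk k, by positivity, h0, h1, fun k _ => ⟨hid k,
    (hid k).one_sub, add_sub_cancel _ _⟩, fun k _ => ?_, fun k _ _ => ⟨hmap _ _ _ (hPA k),
      hmap _ _ _ fun v => ?_⟩, ?_, ?_, fun k hk => ?_⟩
  · refine ⟨Submodule.disjoint_def.2 ?_, codisjoint_iff.2 (Submodule.eq_top_iff'.2 fun v => ?_)⟩
    · rintro _ ⟨v, rfl⟩ ⟨u, hu⟩
      have h2 : Pk k (Pk k v) = Pk k v := DFunLike.congr_fun (hid k) v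
      have h3 : Pk k (Pk k u) = Pk k u := DFunLike.congr_fun (hid k) u
      have hu' : u - Pk k u = Pk k v := hu
      change Pk k v = 0
      rw [← h2, ← hu', map_sub, h3, sub_self]
    · exact Submodule.mem_sup.2 ⟨Pk k v, ⟨v, rfl⟩, (1 - Pk k) v, ⟨v, rfl⟩, by simp⟩
  · change A k v - Pk (k + 1) (A k v) = A k (v - Pk k v)
    rw [hPA, map_sub]
  · rintro k hk l hl hkl _ ⟨v, rfl⟩
    have h := hS k hk l hl hkl (cauchyMatrix A 0 l v)
    change ‖cauchyMatrix A k l (Pk l v)‖ ≤ (K + 1) * lam ^ (k - l) * ‖Pk l v‖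
    rw [hPk, cauchyMatrix_comp]
    refine h.trans ?_
    gcongr
    linarith
  · rintro k hk l hl hkl _ ⟨v, rfl⟩
    have h := hU k hk l hl hkl (cauchyMatrix A 0 l v)
    change ‖cauchyMatrix A k l ((1 - Pk l) v)‖ ≤ (K + 1) * lam ^ (l - k) * ‖(1 - Pk l) v‖
    rw [hQk, cauchyMatrix_comp]
    refine h.trans ?_
    gcongr
    linarith
  · have h : ∀ v, ‖Pk k v‖ ≤ K * ‖v‖ := fun v => by
      simpa [cauchyMatrix_comp, hPk] using hbd k hk (cauchyMatrix A 0 k v)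
    refine ⟨ContinuousLinearMap.opNorm_le_bound _ (by positivity) fun v => (h v).trans ?_,
      ContinuousLinearMap.opNorm_le_bound _ (by positivity) fun v => ?_⟩
    · gcongr; linarith
    · calc ‖v - Pk k v‖ ≤ ‖v‖ + K * ‖v‖ := norm_sub_le_of_le le_rfl (h v)
        _ = (K + 1) * ‖v‖ := by ring

/-- An exponential dichotomy for the evolution `V` from solvability in the weighted space. -/
theorem exists_weighted_dichotomy {ω : ℝ} (hω : 0 ≤ ω) {V : ℕ → (Vec d ≃L[ℝ] Vec d)}
    (hV : ∀ f : ℕ → Vec d, (∃ C, ∀ n : ℕ, ‖f n‖ * polyWeight ω n ≤ C) →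
      ∃ y : ℕ → Vec d, (∃ C, ∀ n : ℕ, ‖y n‖ * polyWeight ω n ≤ C) ∧
        ∀ n, y (n + 1) = V (n + 1) ((V n).symm (y n)) + f (n + 1)) :
    ∃ (K lam : ℝ) (P : Vec d →L[ℝ] Vec d), 0 < K ∧ 0 < lam ∧ lam < 1 ∧ IsIdempotentElem P ∧
      (∀ v, (∃ C, ∀ n : ℕ, ‖V n v‖ * polyWeight ω n ≤ C) → P v = v) ∧
      (∀ l n v, ‖V (l + n) (P v)‖ ≤ K * lam ^ n * ‖V l (P v)‖) ∧
      (∀ l n v, ‖V l (v - P v)‖ ≤ K * lam ^ n * ‖V (l + n) (v - P v)‖) ∧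
      (∀ n v, ‖V n (P v)‖ ≤ K * ‖V n v‖) := by
  have hw := polyWeight_pos ω
  let c : ℕ → ℝˣ := fun n => Units.mk0 (polyWeight ω n) (hw n).ne'
  let U : ℕ → (Vec d ≃L[ℝ] Vec d) := fun n =>
    (V n).trans (ContinuousLinearEquiv.smulLeft (c n))
  have hUV : ∀ n v, U n v = polyWeight ω n • V n v := fun n v => rfl
  have hUs : ∀ n v, (U n).symm v = (polyWeight ω n)⁻¹ • (V n).symm v := fun n v => by
    rw [ContinuousLinearEquiv.symm_apply_eq, hUV, map_smul,
      ContinuousLinearEquiv.apply_symm_apply, smul_inv_smul₀ (hw n).ne']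
  have hnorm : ∀ n v, ‖U n v‖ = ‖V n v‖ * polyWeight ω n := fun n v => by
    rw [hUV, norm_smul, Real.norm_of_nonneg (hw n).le, mul_comm]
  obtain ⟨K, lam, P, hK, h0, h1, hP, hPv, hS, hN, hbd⟩ := exists_dichotomy (U := U) (by
    rintro f ⟨C, hC⟩
    have hn : ∀ (n : ℕ) (u : Vec d), ‖(polyWeight ω n)⁻¹ • u‖ * polyWeight ω n = ‖u‖ := by
      intro n u
      rw [norm_smul, norm_inv, Real.norm_of_nonneg (hw n).le, mul_comm,
        mul_inv_cancel_left₀ (hw n).ne']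
    obtain ⟨y, ⟨D, hD⟩, hy⟩ := hV (fun n => (polyWeight ω n)⁻¹ • f n)
      ⟨C, fun n => by rw [hn]; exact hC n⟩
    refine ⟨fun n => polyWeight ω n • y n, ⟨D, fun n => ?_⟩, fun n => ?_⟩
    · rw [norm_smul, Real.norm_of_nonneg (hw n).le, mul_comm]
      exact hD n
    · beta_reduce
      rw [hy, smul_add, smul_inv_smul₀ (hw _).ne', hUV, hUs, map_smul, map_smul, map_smul,
        inv_smul_smul₀ (hw _).ne'])
  obtain ⟨C, μ, hC, hμ0, hμ1, hCμ⟩ := exists_rpow_mul_pow_le h0 h1 ω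
  -- Removing the weight only helps the stable estimate, as the weight increases. The other estimate
  -- loses `(n + 1) ^ ω`, absorbed in passing from `lam` to `μ`.
  refine ⟨K * C + K, μ, P, by positivity, hμ0, hμ1, hP, fun v hv => hPv v (by simpa [hnorm] using hv),
    fun l n v => ?_, fun l n v => ?_, fun n v => ?_⟩
  · have h := hS l n v
    rw [hnorm, hnorm] at h
    have h2 : ‖V (l + n) (P v)‖ ≤ K * lam ^ n * ‖V l (P v)‖ := by
      refine le_of_mul_le_mul_right (h.trans ?_) (hw (l + n : ℕ))
      rw [← mul_assoc]
      gcongr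
      exact polyWeight_mono hω (Nat.le_add_right l n)
    have h3 : lam ^ n ≤ C * μ ^ n := by
      refine le_trans ?_ (hCμ n)
      exact le_mul_of_one_le_left (by positivity) (Real.one_le_rpow (by simp) hω)
    calc _ ≤ K * lam ^ n * ‖V l (P v)‖ := h2
      _ ≤ K * (C * μ ^ n) * ‖V l (P v)‖ := by gcongr
      _ = K * C * μ ^ n * ‖V l (P v)‖ := by ring
      _ ≤ _ := by gcongr; linarith
  · have h := hN l n v
    rw [hnorm, hnorm] at h
    have h2 : ‖V l (v - P v)‖ ≤ K * (((n : ℝ) + 1) ^ ω * lam ^ n) * ‖V (l + n) (v - P v)‖ := by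
      refine le_of_mul_le_mul_right (h.trans ?_) (hw l)
      have h4 := polyWeight_le_mul hω ((l + n : ℕ) : ℤ) l
      have h5 : (((l + n : ℕ) : ℤ) - l).natAbs = n := by omega
      rw [h5] at h4
      calc K * lam ^ n * (‖V (l + n) (v - P v)‖ * polyWeight ω (l + n : ℕ))
          ≤ K * lam ^ n * (‖V (l + n) (v - P v)‖ * (polyWeight ω l * ((n : ℝ) + 1) ^ ω)) := by
            gcongr
        _ = _ := by ring
    calc _ ≤ _ := h2
      _ ≤ K * (C * μ ^ n) * ‖V (l + n) (v - P v)‖ := by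
        gcongr K * ?_ * _
        exact hCμ n
      _ = K * C * μ ^ n * ‖V (l + n) (v - P v)‖ := by ring
      _ ≤ _ := by gcongr; linarith
  · have h := hbd n v
    rw [hnorm, hnorm, ← mul_assoc] at h
    refine (le_of_mul_le_mul_right h (hw n)).trans ?_
    gcongr
    exact le_add_of_nonneg_left (by positivity)

theorem cauchyMatrix_step (k : ℤ) (v : Vec d) :
    cauchyMatrix A (k + 1) 0 ((cauchyMatrix A k 0).symm v) = A k v := by
  rw [cauchyMatrix_symm, cauchyMatrix_comp, cauchyMatrix_succ, cauchyMatrix_self]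

/-- The consequences of the Perron property on the half-line of non-negative integers. -/
theorem PerronProperty.forward {ω : ℝ} (hω : 0 ≤ ω) (h : PerronProperty ω A) :
    HyperbolicOn A {k : ℤ | 0 ≤ k} ∧
      ∀ v, (∃ C, ∀ n : ℕ, ‖cauchyMatrix A n 0 v‖ * polyWeight ω n ≤ C) → v ∈ stableSpace A := by
  obtain ⟨K, lam, P, hK, h0, h1, hP, hPv, hS, hN, hbd⟩ :=
    exists_weighted_dichotomy hω (V := fun n => cauchyMatrix A n 0) (by
      rintro f ⟨C, hC⟩
      have hC0 : 0 ≤ C := le_trans (mul_nonneg (norm_nonneg _) (polyWeight_pos _ _).le) (hC 0)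
      obtain ⟨x, ⟨D, hD⟩, hx⟩ := h (fun k => if 0 ≤ k then f k.toNat else 0)
        ⟨C, fun k => by
          beta_reduce
          split_ifs with hk
          · have := hC k.toNat
            rwa [Int.toNat_of_nonneg hk] at this
          · simpa using hC0⟩
      refine ⟨fun n => x n, ⟨D, fun n => hD n⟩, fun n => ?_⟩
      have h2 := hx n
      rw [if_pos (by omega), show ((n : ℤ) + 1).toNat = n + 1 by omega] at h2
      push_cast
      rw [h2, cauchyMatrix_step])
  refine ⟨hyperbolicOn_of_idempotent hK h0 h1 hP ?_ ?_ ?_, fun v hv => ?_⟩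
  · intro k (hk : 0 ≤ k) l (hl : 0 ≤ l) hkl v
    lift l to ℕ using hl
    obtain ⟨n, rfl⟩ := Int.le.dest hkl
    simpa using hS l n v
  · intro k (hk : 0 ≤ k) l (hl : 0 ≤ l) hkl v
    lift k to ℕ using hk
    obtain ⟨n, rfl⟩ := Int.le.dest hkl
    simpa using hN k n v
  · intro k (hk : 0 ≤ k) v
    lift k to ℕ using hk
    exact hbd k v
  · have h2 : Tendsto (fun n : ℕ => ‖cauchyMatrix A (n : ℤ) 0 v‖) atTop (𝓝 0) := by
      have h3 : Tendsto (fun n : ℕ => K * lam ^ n * ‖v‖) atTop (𝓝 0) := by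
        simpa using ((tendsto_pow_atTop_nhds_zero_of_lt_one h0.le h1).const_mul K).mul_const ‖v‖
      refine squeeze_zero (fun _ => norm_nonneg _) (fun n => ?_) h3
      have := hS 0 n v
      rw [hPv v hv] at this
      simpa using this
    have h4 : Tendsto (fun k : ℤ => ‖cauchyMatrix A (k.toNat : ℤ) 0 v‖) atTop (𝓝 0) :=
      h2.comp (tendsto_atTop.2 fun b => (eventually_ge_atTop (b : ℤ)).mono fun k hk => by omega)
    refine h4.congr' ((eventually_ge_atTop 0).mono fun k hk => ?_)
    rw [Int.toNat_of_nonneg hk]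

/-- The consequences of the Perron property on the half-line of non-positive integers. -/
theorem PerronProperty.backward {ω : ℝ} (hω : 0 ≤ ω) {M : ℝ} (hM : 0 < M)
    (hA : ∀ k : ℤ, ‖(A k : Vec d →L[ℝ] Vec d)‖ ≤ M) (h : PerronProperty ω A) :
    HyperbolicOn A {k : ℤ | k ≤ 0} ∧
      ∀ v, (∃ C, ∀ n : ℕ, ‖cauchyMatrix A (-n) 0 v‖ * polyWeight ω n ≤ C) →
        v ∈ unstableSpace A := by
  obtain ⟨K, lam, P, hK, h0, h1, hP, hPv, hS, hN, hbd⟩ :=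
    exists_weighted_dichotomy hω (V := fun n => cauchyMatrix A (-n) 0) (by
      rintro f ⟨C, hC⟩
      have hC0 : 0 ≤ C := le_trans (mul_nonneg (norm_nonneg _) (polyWeight_pos _ _).le) (hC 0)
      obtain ⟨x, ⟨D, hD⟩, hx⟩ := h
        -- Reversing time turns the forcing at `-n` into `-(A (-n - 1))⁻¹` of it at reversed time `n
        -- + 1`; this choice makes that equal to `f (n + 1)`.
        (fun k => if k ≤ 0 then -A (k - 1) (f ((-k).toNat + 1)) else 0)
        ⟨M * C, fun k => by
          beta_reduce
          split_ifs with hk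
          · obtain ⟨n, rfl⟩ := Int.exists_eq_neg_ofNat hk
            change ‖-A (-(n : ℤ) - 1) _‖ * polyWeight ω (-(n : ℤ)) ≤ M * C
            rw [neg_neg, Int.toNat_natCast, norm_neg, polyWeight_neg]
            calc ‖A (-(n : ℤ) - 1) (f (n + 1))‖ * polyWeight ω n
                ≤ (M * ‖f (n + 1)‖) * polyWeight ω (n + 1 : ℕ) := by
                  gcongr
                  · exact (polyWeight_pos _ _).le
                  · exact ContinuousLinearMap.le_of_opNorm_le
                      (A (-(n : ℤ) - 1) : Vec d →L[ℝ] Vec d) (hA _) _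
                  · exact polyWeight_mono hω n.le_succ
              _ ≤ M * C := by rw [mul_assoc]; gcongr; exact hC _
          · simpa using mul_nonneg hM.le hC0⟩
      refine ⟨fun n => x (-n), ⟨D, fun n => ?_⟩, fun n => ?_⟩
      · have := hD (-n)
        rwa [← polyWeight, polyWeight_neg] at this
      · have h2 := hx (-(n : ℤ) - 1)
        rw [sub_add_cancel, if_pos (by omega), neg_neg, Int.toNat_natCast] at h2
        have h3 : (-((n + 1 : ℕ) : ℤ)) = -(n : ℤ) - 1 := by push_cast; ring
        apply (A (-(n : ℤ) - 1)).injective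
        beta_reduce
        rw [h3, map_add, ← cauchyMatrix_succ, sub_add_cancel,
          ContinuousLinearEquiv.apply_symm_apply, h2]
        abel)
  -- Time reversal exchanges the roles of the two subspaces, so `1 - P` is the stable projection.
  refine ⟨hyperbolicOn_of_idempotent (K := K + 1) (by positivity) h0 h1 hP.one_sub ?_ ?_ ?_,
    fun v hv => ?_⟩
  · intro k (hk : k ≤ 0) l (hl : l ≤ 0) hkl v
    obtain ⟨k, rfl⟩ := Int.exists_eq_neg_ofNat hk
    obtain ⟨n, hn⟩ := Int.le.dest hkl
    obtain rfl : l = -((k + n : ℕ) : ℤ) := by push_cast; omega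
    have h2 : -(k : ℤ) - -((k + n : ℕ) : ℤ) = n := by push_cast; ring
    rw [h2, zpow_natCast]
    refine (hN k n v).trans ?_
    change _ ≤ (K + 1) * lam ^ n * ‖cauchyMatrix A (-((k + n : ℕ) : ℤ)) 0 (v - P v)‖
    gcongr
    linarith
  · intro k (hk : k ≤ 0) l (hl : l ≤ 0) hkl v
    obtain ⟨l, rfl⟩ := Int.exists_eq_neg_ofNat hl
    obtain ⟨n, hn⟩ := Int.le.dest hkl
    obtain rfl : k = -((l + n : ℕ) : ℤ) := by push_cast; omega
    have h2 : -(l : ℤ) - -((l + n : ℕ) : ℤ) = n := by push_cast; ring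
    have h3 : v - (1 - P) v = P v := by simp
    rw [h2, zpow_natCast, h3]
    refine (hS l n v).trans ?_
    gcongr
    linarith
  · intro k (hk : k ≤ 0) v
    obtain ⟨k, rfl⟩ := Int.exists_eq_neg_ofNat hk
    change ‖cauchyMatrix A (-(k : ℤ)) 0 (v - P v)‖ ≤ _
    rw [map_sub]
    have := norm_sub_le_of_le (le_refl ‖cauchyMatrix A (-(k : ℤ)) 0 v‖) (hbd k v)
    linarith
  · have h2 : Tendsto (fun n : ℕ => ‖cauchyMatrix A (-(n : ℤ)) 0 v‖) atTop (𝓝 0) := by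
      have h3 : Tendsto (fun n : ℕ => K * lam ^ n * ‖v‖) atTop (𝓝 0) := by
        simpa using ((tendsto_pow_atTop_nhds_zero_of_lt_one h0.le h1).const_mul K).mul_const ‖v‖
      refine squeeze_zero (fun _ => norm_nonneg _) (fun n => ?_) h3
      have := hS 0 n v
      rw [hPv v hv] at this
      simpa using this
    have h4 : Tendsto (fun k : ℤ => ‖cauchyMatrix A (-((-k).toNat : ℤ)) 0 v‖) atBot (𝓝 0) :=
      h2.comp (tendsto_atTop.2 fun b => (eventually_le_atBot (-b : ℤ)).mono fun k hk => by omega)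
    refine h4.congr' ((eventually_le_atBot 0).mono fun k hk => ?_)
    rw [Int.toNat_of_nonneg (by omega), neg_neg]

/-- The response to an impulse `ξ` at time 0 is the trajectory of `x 0` forward and of `x 0 - ξ`
backward, so `ξ` is a difference of a stable and an unstable vector. -/
theorem PerronProperty.transverse {ω : ℝ} (h : PerronProperty ω A)
    (hs : ∀ v, (∃ C, ∀ n : ℕ, ‖cauchyMatrix A n 0 v‖ * polyWeight ω n ≤ C) → v ∈ stableSpace A)
    (hu : ∀ v, (∃ C, ∀ n : ℕ, ‖cauchyMatrix A (-n) 0 v‖ * polyWeight ω n ≤ C) →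
      v ∈ unstableSpace A) : Transverse (stableSpace A) (unstableSpace A) := by
  refine Submodule.eq_top_iff'.2 fun ξ => ?_
  obtain ⟨x, ⟨C, hC⟩, hx⟩ := h (fun k => if k = 0 then ξ else 0) ⟨‖ξ‖, fun k => by
    beta_reduce
    split_ifs with hk <;> simp [hk]⟩
  have hpos : ∀ n : ℕ, x n = cauchyMatrix A n 0 (x 0) := by
    intro n
    induction n with
    | zero => simp
    | succ n ih =>
      push_cast
      rw [hx, if_neg (by omega), add_zero, ih, cauchyMatrix_succ]
  have hneg : ∀ n : ℕ, x (-(n + 1 : ℕ)) = cauchyMatrix A (-(n + 1 : ℕ)) 0 (x 0 - ξ) := by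
    intro n
    induction n with
    | zero =>
      have h1 := hx (-1)
      have h2 : (-1 : ℤ) + 1 = 0 := by norm_num
      rw [h2, if_pos rfl] at h1
      change x (-1) = cauchyMatrix A (-1) 0 (x 0 - ξ)
      apply (A (-1)).injective
      rw [← cauchyMatrix_succ, h2, cauchyMatrix_self, h1, add_sub_cancel_right]
    | succ n ih =>
      apply (A (-(n + 1 + 1 : ℕ))).injective
      have h1 := hx (-(n + 1 + 1 : ℕ))
      have h2 : (-((n + 1 + 1 : ℕ) : ℤ)) + 1 = -((n + 1 : ℕ) : ℤ) := by push_cast; ring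
      rw [← cauchyMatrix_succ, h2, ← ih]
      rw [h2, if_neg (by omega), add_zero] at h1
      exact h1.symm
  -- The backward bound gains `‖x 0 - ξ‖` for `n = 0`, where `x` has already jumped.
  refine Submodule.mem_sup.2 ⟨x 0, hs _ ⟨C, fun n => ?_⟩, -(x 0 - ξ),
    neg_mem (hu _ ⟨C + ‖x 0 - ξ‖, fun n => ?_⟩), by abel⟩
  · rw [← hpos]
    exact hC n
  · have hC0 : 0 ≤ C := le_trans (mul_nonneg (norm_nonneg _) (polyWeight_pos _ _).le) (hC 0)
    rcases n with _ | n
    · simpa [polyWeight] using hC0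
    · rw [← hneg, ← polyWeight_neg]
      exact (hC _).trans (le_add_of_nonneg_right (norm_nonneg _))

end Forward

/-! ### From hyperbolicity and transversality to the Perron property -/

section Backward

variable {d : ℕ} {A : ℤ → (Vec d ≃L[ℝ] Vec d)}

-- Sum of the Green's function `g`: the `P` part over the past, minus the `Q` part over the future.
-- Moving the weight from `k` to `l` costs a power of `|k - l| + 1`, which the exponential absorbs.
open Classical in
theorem HyperbolicOn.exists_solution {I : Set ℤ} (hI : HyperbolicOn A I) {ω : ℝ} (hω : 0 ≤ ω)
    {f : ℤ → Vec d} (hf : MemWeighted ω f) :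
    ∃ x : ℤ → Vec d, (∃ C, ∀ k ∈ I, ‖x k‖ * polyWeight ω k ≤ C) ∧
      ∀ k ∈ I, k + 1 ∈ I → x (k + 1) = A k (x k) + f (k + 1) := by
  obtain ⟨K, lam, P, Q, hK, h0, h1, hPQ, -, -, hS, hU, hbd⟩ := hI
  obtain ⟨F, hF⟩ := hf
  have hF' : ∀ l, ‖f l‖ * polyWeight ω l ≤ F := hF
  obtain ⟨C, μ, hC, hμ0, hμ1, hCμ⟩ := exists_rpow_mul_pow_le h0 h1 ω
  have hw := polyWeight_pos ω
  let g : ℤ → ℤ → Vec d := fun k l =>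
    if l ∈ I then if l ≤ k then cauchyMatrix A k l (P l (f l)) else -cauchyMatrix A k l (Q l (f l))
    else 0
  have hF0 : 0 ≤ F := le_trans (mul_nonneg (norm_nonneg _) (hw 0).le) (hF' 0)
  have hg : ∀ k ∈ I, ∀ l, ‖g k l‖ ≤ K * lam ^ (k - l).natAbs * (K * ‖f l‖) := by
    intro k hk l
    by_cases hl : l ∈ I
    · by_cases hlk : l ≤ k
      · have h := hS k hk l hl hlk (P l (f l)) ⟨f l, rfl⟩
        have e : k - l = ((k - l).natAbs : ℤ) := by omega
        rw [e, zpow_natCast] at h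
        simp only [g, if_pos hl, if_pos hlk]
        refine h.trans ?_
        gcongr
        exact (P l).le_of_opNorm_le (hbd l hl).1 _
      · have h := hU k hk l hl (not_le.1 hlk).le (Q l (f l)) ⟨f l, rfl⟩
        have e : l - k = ((k - l).natAbs : ℤ) := by omega
        rw [e, zpow_natCast] at h
        simp only [g, if_pos hl, if_neg hlk, norm_neg]
        refine h.trans ?_
        gcongr
        exact (Q l).le_of_opNorm_le (hbd l hl).2 _
    · simp only [g, if_neg hl, norm_zero]
      positivity
  have hgw : ∀ k ∈ I, ∀ l, ‖g k l‖ ≤ K * K * C * F / polyWeight ω k * μ ^ (k - l).natAbs := by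
    intro k hk l
    rw [div_mul_eq_mul_div, le_div_iff₀ (hw k)]
    calc ‖g k l‖ * polyWeight ω k
        ≤ K * lam ^ (k - l).natAbs * (K * ‖f l‖) *
          (polyWeight ω l * (((k - l).natAbs : ℝ) + 1) ^ ω) :=
          mul_le_mul (hg k hk l) (polyWeight_le_mul hω k l) (hw k).le (by positivity)
      _ = K * K * ((((k - l).natAbs : ℝ) + 1) ^ ω * lam ^ (k - l).natAbs) *
          (‖f l‖ * polyWeight ω l) := by ring
      _ ≤ K * K * (C * μ ^ (k - l).natAbs) * F := by
          refine mul_le_mul ?_ (hF' l) (mul_nonneg (norm_nonneg _) (hw l).le) (by positivity)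
          exact mul_le_mul_of_nonneg_left (hCμ _) (by positivity)
      _ = _ := by ring
  set S := ∑' n : ℤ, μ ^ n.natAbs with hS
  have hsum : ∀ k : ℤ, HasSum (fun l : ℤ => μ ^ (k - l).natAbs) S := fun k =>
    (Equiv.subLeft k).hasSum_iff (f := fun n : ℤ => μ ^ n.natAbs) |>.2
      (summable_pow_natAbs hμ0 hμ1).hasSum
  have hgs : ∀ k ∈ I, Summable (g k) := fun k hk =>
    Summable.of_norm_bounded ((hsum k).mul_left _).summable (hgw k hk)
  refine ⟨fun k => ∑' l, g k l, ⟨K * K * C * F * S, fun k hk => ?_⟩, fun k hk hk1 => ?_⟩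
  · have h := tsum_of_norm_bounded ((hsum k).mul_left _) (hgw k hk)
    rwa [div_mul_eq_mul_div, le_div_iff₀ (hw k)] at h
  · have h2 : ∑' l, (g (k + 1) l - A k (g k l)) = f (k + 1) := by
      rw [tsum_eq_single (k + 1)]
      · have h3 : P (k + 1) (f (k + 1)) + Q (k + 1) (f (k + 1)) = f (k + 1) :=
          DFunLike.congr_fun (hPQ (k + 1) hk1).2.2 _
        simp only [g, if_pos hk1, le_refl, if_true, cauchyMatrix_self]
        rw [if_neg (by omega), map_neg, ← cauchyMatrix_succ, cauchyMatrix_self, sub_neg_eq_add, h3]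
      · intro l hl
        by_cases hlI : l ∈ I
        · by_cases hlk : l ≤ k
          · simp only [g, if_pos hlI, if_pos hlk, if_pos (show l ≤ k + 1 by omega),
              cauchyMatrix_succ, sub_self]
          · simp only [g, if_pos hlI, if_neg hlk, if_neg (show ¬l ≤ k + 1 by omega), map_neg,
              cauchyMatrix_succ, sub_self]
        · simp [g, hlI]
    have h4 : Summable fun l => A k (g k l) := (hgs k hk).map (A k) (A k).continuous
    rw [Summable.tsum_sub (hgs _ hk1) h4] at h2
    beta_reduce
    rw [ContinuousLinearEquiv.map_tsum, ← h2]
    abel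

/-- A trajectory tending to 0 has no `Q` component, since that component would have to grow
exponentially. It therefore decays exponentially, faster than any weight. -/
theorem HyperbolicOn.stableSpace_bound (hI : HyperbolicOn A {k : ℤ | 0 ≤ k}) (ω : ℝ)
    {b : Vec d} (hb : b ∈ stableSpace A) :
    ∃ C, ∀ k : ℤ, 0 ≤ k → ‖cauchyMatrix A k 0 b‖ * polyWeight ω k ≤ C := by
  obtain ⟨K, lam, P, Q, hK, h0, h1, hPQ, -, hmap, hS, hU, -⟩ := hI
  obtain ⟨C, μ, hC, hμ0, hμ1, hCμ⟩ := exists_rpow_mul_pow_le h0 h1 ω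
  have hmem0 : (0 : ℤ) ∈ {k : ℤ | 0 ≤ k} := le_refl (0 : ℤ)
  have hsum : P 0 b + Q 0 b = b := DFunLike.congr_fun (hPQ 0 hmem0).2.2 b
  have hpow : Tendsto (fun n : ℕ => lam ^ n) atTop (𝓝 0) :=
    tendsto_pow_atTop_nhds_zero_of_lt_one h0.le h1
  have hSn : ∀ n : ℕ, ‖cauchyMatrix A n 0 (P 0 b)‖ ≤ K * lam ^ n * ‖P 0 b‖ := fun n => by
    simpa using hS n (Int.natCast_nonneg n) 0 hmem0 (Int.natCast_nonneg n) _ ⟨b, rfl⟩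
  have hmem : ∀ n : ℕ, cauchyMatrix A n 0 (Q 0 b) ∈ (Q n).range := by
    intro n
    induction n with
    | zero => simp
    | succ n ih =>
      push_cast
      rw [cauchyMatrix_succ, ← (hmap n (Int.natCast_nonneg n) (by simp; omega)).2]
      exact ⟨_, ih, rfl⟩
  have hbn : Tendsto (fun n : ℕ => ‖cauchyMatrix A n 0 b‖) atTop (𝓝 0) :=
    (show Tendsto (fun k : ℤ => ‖cauchyMatrix A k 0 b‖) atTop (𝓝 0) from hb).comp
      tendsto_natCast_atTop_atTop
  have hQ : Q 0 b = 0 := by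
    have hlim : Tendsto (fun n : ℕ => K * lam ^ n *
        (‖cauchyMatrix A n 0 b‖ + K * lam ^ n * ‖P 0 b‖)) atTop (𝓝 0) := by
      simpa using (hpow.const_mul K).mul (hbn.add ((hpow.const_mul K).mul_const ‖P 0 b‖))
    refine norm_le_zero_iff.1 (ge_of_tendsto' hlim fun n => ?_)
    have h := hU 0 hmem0 n (Int.natCast_nonneg n) (Int.natCast_nonneg n) _ (hmem n)
    rw [cauchyMatrix_comp, cauchyMatrix_self, sub_zero, zpow_natCast] at h
    refine h.trans ?_
    gcongr
    have e : cauchyMatrix A n 0 (Q 0 b) = cauchyMatrix A n 0 b - cauchyMatrix A n 0 (P 0 b) := by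
      rw [← map_sub]; congr 1; rw [eq_sub_iff_add_eq, add_comm, hsum]
    rw [e]
    exact norm_sub_le_of_le le_rfl (hSn n)
  rw [hQ, add_zero] at hsum
  refine ⟨K * C * ‖b‖, fun k hk => ?_⟩
  lift k to ℕ using hk
  have h := hSn k
  rw [hsum] at h
  have hw : polyWeight ω k = ((k : ℝ) + 1) ^ ω := by simp [polyWeight]
  calc ‖cauchyMatrix A k 0 b‖ * polyWeight ω k
      ≤ K * lam ^ k * ‖b‖ * polyWeight ω k := mul_le_mul_of_nonneg_right h (polyWeight_pos _ _).le
    _ = K * (((k : ℝ) + 1) ^ ω * lam ^ k) * ‖b‖ := by rw [hw]; ring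
    _ ≤ K * (C * 1) * ‖b‖ := by
      gcongr K * ?_ * ‖b‖
      refine (hCμ k).trans ?_
      gcongr
      exact pow_le_one₀ hμ0.le hμ1.le
    _ = _ := by ring

theorem HyperbolicOn.unstableSpace_bound (hI : HyperbolicOn A {k : ℤ | k ≤ 0}) (ω : ℝ)
    {b : Vec d} (hb : b ∈ unstableSpace A) :
    ∃ C, ∀ k : ℤ, k ≤ 0 → ‖cauchyMatrix A k 0 b‖ * polyWeight ω k ≤ C := by
  obtain ⟨K, lam, P, Q, hK, h0, h1, hPQ, -, hmap, hS, hU, -⟩ := hI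
  obtain ⟨C, μ, hC, hμ0, hμ1, hCμ⟩ := exists_rpow_mul_pow_le h0 h1 ω
  have hmem0 : (0 : ℤ) ∈ {k : ℤ | k ≤ 0} := le_refl (0 : ℤ)
  have hsum : P 0 b + Q 0 b = b := DFunLike.congr_fun (hPQ 0 hmem0).2.2 b
  have hpow : Tendsto (fun n : ℕ => lam ^ n) atTop (𝓝 0) :=
    tendsto_pow_atTop_nhds_zero_of_lt_one h0.le h1
  have hle : ∀ n : ℕ, -(n : ℤ) ≤ 0 := fun n => by omega
  have hUn : ∀ n : ℕ, ‖cauchyMatrix A (-n) 0 (Q 0 b)‖ ≤ K * lam ^ n * ‖Q 0 b‖ := fun n => by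
    simpa using hU (-n) (hle n) 0 hmem0 (hle n) _ ⟨b, rfl⟩
  have hmem : ∀ n : ℕ, cauchyMatrix A (-n) 0 (P 0 b) ∈ (P (-n)).range := by
    intro n
    induction n with
    | zero => simp
    | succ n ih =>
      have e : -((n + 1 : ℕ) : ℤ) + 1 = -(n : ℤ) := by push_cast; ring
      have h := (hmap (-((n + 1 : ℕ) : ℤ)) (hle _) (by rw [e]; exact hle n)).1
      rw [e] at h
      rw [← h, ← e, cauchyMatrix_succ] at ih
      obtain ⟨u, hu, hu'⟩ := ih
      -- Invariance is used backwards: injectivity of `A` pulls membership in the range back one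
      -- step.
      rwa [← (A _).injective hu']
  have hbn : Tendsto (fun n : ℕ => ‖cauchyMatrix A (-n) 0 b‖) atTop (𝓝 0) :=
    (show Tendsto (fun k : ℤ => ‖cauchyMatrix A k 0 b‖) atBot (𝓝 0) from hb).comp
      (tendsto_neg_atTop_atBot.comp tendsto_natCast_atTop_atTop)
  have hP : P 0 b = 0 := by
    have hlim : Tendsto (fun n : ℕ => K * lam ^ n *
        (‖cauchyMatrix A (-n) 0 b‖ + K * lam ^ n * ‖Q 0 b‖)) atTop (𝓝 0) := by
      simpa using (hpow.const_mul K).mul (hbn.add ((hpow.const_mul K).mul_const ‖Q 0 b‖))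
    refine norm_le_zero_iff.1 (ge_of_tendsto' hlim fun n => ?_)
    have h := hS 0 hmem0 (-n) (hle n) (hle n) _ (hmem n)
    rw [cauchyMatrix_comp, cauchyMatrix_self, zero_sub, neg_neg, zpow_natCast] at h
    refine h.trans ?_
    gcongr
    have e : cauchyMatrix A (-n) 0 (P 0 b) =
        cauchyMatrix A (-n) 0 b - cauchyMatrix A (-n) 0 (Q 0 b) := by
      rw [← map_sub]; congr 1; rw [eq_sub_iff_add_eq, hsum]
    rw [e]
    exact norm_sub_le_of_le le_rfl (hUn n)
  rw [hP, zero_add] at hsum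
  refine ⟨K * C * ‖b‖, fun k hk => ?_⟩
  obtain ⟨k, rfl⟩ := Int.exists_eq_neg_ofNat hk
  have h := hUn k
  rw [hsum] at h
  have hw : polyWeight ω (-(k : ℤ)) = ((k : ℝ) + 1) ^ ω := by simp [polyWeight]
  calc ‖cauchyMatrix A (-(k : ℤ)) 0 b‖ * polyWeight ω (-(k : ℤ))
      ≤ K * lam ^ k * ‖b‖ * polyWeight ω (-(k : ℤ)) :=
        mul_le_mul_of_nonneg_right h (polyWeight_pos _ _).le
    _ = K * (((k : ℝ) + 1) ^ ω * lam ^ k) * ‖b‖ := by rw [hw]; ring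
    _ ≤ K * (C * 1) * ‖b‖ := by
      gcongr K * ?_ * ‖b‖
      refine (hCμ k).trans ?_
      gcongr
      exact pow_le_one₀ hμ0.le hμ1.le
    _ = _ := by ring

theorem perronProperty_of_hyperbolicOn {ω : ℝ} (hω : 0 ≤ ω)
    (hp : HyperbolicOn A {k : ℤ | 0 ≤ k}) (hm : HyperbolicOn A {k : ℤ | k ≤ 0})
    (ht : Transverse (stableSpace A) (unstableSpace A)) : PerronProperty ω A := by
  intro f hf
  obtain ⟨x, ⟨C, hC⟩, hx⟩ := hp.exists_solution hω hf
  obtain ⟨y, ⟨D, hD⟩, hy⟩ := hm.exists_solution hω hf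
  obtain ⟨b, hb, c, hc, hbc⟩ := Submodule.mem_sup.1
    ((show stableSpace A ⊔ unstableSpace A = ⊤ from ht) ▸ Submodule.mem_top :
      x 0 - y 0 ∈ stableSpace A ⊔ unstableSpace A)
  obtain ⟨C', hC'⟩ := hp.stableSpace_bound ω hb
  obtain ⟨D', hD'⟩ := hm.unstableSpace_bound ω hc
  have hw := polyWeight_pos ω
  -- As `x 0 - y 0 = b + c`, the corrected solutions agree at 0, so both formulas hold there and the
  -- step from `-1` to `0` lies in the left half-line.
  let z : ℤ → Vec d := fun k =>
    if 0 ≤ k then x k - cauchyMatrix A k 0 b else y k + cauchyMatrix A k 0 c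
  have hzp : ∀ k, 0 ≤ k → z k = x k - cauchyMatrix A k 0 b := fun k hk => if_pos hk
  have hzm : ∀ k, k ≤ 0 → z k = y k + cauchyMatrix A k 0 c := by
    intro k hk
    rcases hk.lt_or_eq with hk | rfl
    · exact if_neg (not_le.2 hk)
    · rw [hzp 0 le_rfl, cauchyMatrix_self, cauchyMatrix_self, sub_eq_iff_eq_add, add_assoc,
        add_comm c, hbc, add_sub_cancel]
  refine ⟨z, ⟨max (C + C') (D + D'), fun k => ?_⟩, fun k => ?_⟩
  · change ‖z k‖ * polyWeight ω k ≤ _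
    rcases le_total 0 k with hk | hk
    · refine le_max_of_le_left ?_
      calc ‖z k‖ * polyWeight ω k
          ≤ (‖x k‖ + ‖cauchyMatrix A k 0 b‖) * polyWeight ω k := by
            rw [hzp k hk]
            exact mul_le_mul_of_nonneg_right (norm_sub_le _ _) (hw k).le
        _ ≤ C + C' := by rw [add_mul]; exact add_le_add (hC k hk) (hC' k hk)
    · refine le_max_of_le_right ?_
      calc ‖z k‖ * polyWeight ω k
          ≤ (‖y k‖ + ‖cauchyMatrix A k 0 c‖) * polyWeight ω k := by
            rw [hzm k hk]
            exact mul_le_mul_of_nonneg_right (norm_add_le _ _) (hw k).le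
        _ ≤ D + D' := by rw [add_mul]; exact add_le_add (hD k hk) (hD' k hk)
  · rcases le_or_gt 0 k with hk | hk
    · have hk1 : 0 ≤ k + 1 := by omega
      rw [hzp k hk, hzp _ hk1, hx k hk hk1, cauchyMatrix_succ, map_sub]
      abel
    · have hk1 : k + 1 ≤ 0 := by omega
      rw [hzm k hk.le, hzm _ hk1, hy k hk.le hk1, cauchyMatrix_succ, map_add]
      abel

end Backward

theorem mainTheorem1 (d : ℕ) (ω : ℝ) (hω : 0 ≤ ω) (A : ℤ → (Vec d ≃L[ℝ] Vec d))
    (M : ℝ) (hM : 0 < M)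
    (hA : ∀ k : ℤ, ‖(A k : Vec d →L[ℝ] Vec d)‖ ≤ M)
    (hAinv : ∀ k : ℤ, ‖((A k).symm : Vec d →L[ℝ] Vec d)‖ ≤ M) :
    PerronProperty ω A ↔
      HyperbolicOn A {k : ℤ | 0 ≤ k} ∧ HyperbolicOn A {k : ℤ | k ≤ 0} ∧
        Transverse (stableSpace A) (unstableSpace A) :=
  ⟨fun h => ⟨(h.forward hω).1, (h.backward hω hM hA).1,
    h.transverse (h.forward hω).2 (h.backward hω hM hA).2⟩,
    fun ⟨hp, hm, ht⟩ => perronProperty_of_hyperbolicOn hω hp hm ht⟩
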